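/- Let $\mathbb{F}_\infty$ be the free group on $x_1, x_2, \dots$. A word $w \in \mathbb{F}_\infty$ is an identity in a group $G$ if $w(g_1, g_2, \dots) = 1$ for all $g_1, g_2, \dots \in G$. For $W \subseteq \mathbb{F}_\infty$ the variety $\mathcal{V}(W)$ is the class of all groups in which every $w \in W$ is an identity; it is finitely based if it can be defined by a finite set $W$. A word is an identity in a variety $\mathcal{V}$ if it is an identity in every $G \in \mathcal{V}$. For $k, \ell \in \mathbb{N} = \{0, 1, 2, \dots\}$ let $\mathcal{P}(k, \ell)$ be the set of all decompositions into disjoint blocks of a set of $k$ upper points and $\ell$ lower points, each row ordered from left to right. The tensor product of two such partitions is horizontal concatenation; the involution exchanges the two rows; the composition $pq \in \mathcal{P}(k, m)$ of $p \in \mathcal{P}(\ell, m)$ and $q \in \mathcal{P}(k, \ell)$ is obtained by placing $q$ above $p$, identifying the lower points of $q$ with the upper points of $p$, and removing these middle points (components contained in the middle row are discarded). A category of partitions is a set $\mathcal{C}$ of partitions that contains the one-block partitions in $\mathcal{P}(1, 1)$ and in $\mathcal{P}(0, 2)$ and is closed under tensor products, involutions and compositions. It is recursively enumerable if an algorithm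 (Turing machine) enumerates its elements, where a partition is given as a triple $(k, \ell, b)$ with $b \in \mathbb{N}^{k + \ell}$ and two points are in the same block if and only if their entries in $b$ agree. Let $\mathbb{Z}_2^{*\infty}$ be the free product of countably many copies of $\mathbb{Z}_2$ with canonical generators $a_1, a_2, \dots$, let $E$ be its subgroup of all words of even length, and let $\Phi \colon \mathbb{F}_\infty \to E$ be the isomorphism with $\Phi(x_n) = a_1 a_{n+1}$ for all $n \geq 1$. For indices $i_1, \dots, i_n$ let $p(i_1, \dots, i_n) \in \mathcal{P}(0, n)$ be the partition in which the points $s$ and $t$ are in the same block if and only if $i_s = i_t$. Lemma. For every finitely based variety of groups $\mathcal{V}$ there is a recursively enumerable category of partitions $\mathcal{C}$ such that for every $w \in \mathbb{F}_\infty$ and for every expression $\Phi(w) = a_{i_1} \cdots a_{i_n}$ of its image in the generators (reduced or not), \[ w \text{ is an identity in } \mathcal{V} \quad \Longleftrightarrow \quad p(i_1, \dots, i_n) \in \mathcal{C}. \] That is, $w$ is an identity in $\mathcal{V}$ if and only if $p(w) \in \mathcal{C}$, where $p(w) := p(i_1, \dots, i_n)$ for any such expression. -/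

import Mathlib

universe u

/-- A partition with `k` upper points and `l` lower points, i.e. a decomposition of the `k + l` points
into disjoint blocks, given by the relation "lies in the same block as".
`Sum.inl i` is the `i`-th upper point, `Sum.inr j` is the `j`-th lower point (both from the left). -/
abbrev PointPartition (k l : ℕ) : Type := Setoid (Fin k ⊕ Fin l)

namespace PointPartition

/-- Two equivalence relations side by side on a disjoint union. -/
def disjointSum {α β : Type} (r : Setoid α) (s : Setoid β) : Setoid (α ⊕ β) where
  r := Sum.LiftRel r s
  iseqv :=
    { refl := by
        rintro (x | x)
        · exact Sum.LiftRel.inl (r.refl x)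
        · exact Sum.LiftRel.inr (s.refl x)
      symm := by
        rintro _ _ (h | h)
        · exact Sum.LiftRel.inl (r.symm h)
        · exact Sum.LiftRel.inr (s.symm h)
      trans := by
        rintro _ _ _ (h | h) h'
        · cases h' with
          | inl h' => exact Sum.LiftRel.inl (r.trans h h')
        · cases h' with
          | inr h' => exact Sum.LiftRel.inr (s.trans h h') }

/-- The tensor product: horizontal concatenation, `p` to the left of `q`. -/
def tensor {k₁ l₁ k₂ l₂ : ℕ} (p : PointPartition k₁ l₁) (q : PointPartition k₂ l₂) :
    PointPartition (k₁ + k₂) (l₁ + l₂) :=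
  Setoid.comap
    ((Equiv.sumSumSumComm (Fin k₁) (Fin l₁) (Fin k₂) (Fin l₂)).trans
      (Equiv.sumCongr finSumFinEquiv finSumFinEquiv)).symm
    (disjointSum p q)

/-- The involution: the upper and the lower row are exchanged. -/
def involution {k l : ℕ} (p : PointPartition k l) : PointPartition l k :=
  Setoid.comap Sum.swap p

/-- The diagram with upper row `Fin k`, middle row `Fin l` and lower row `Fin m` obtained by placing
`q` above `p`: the smallest equivalence relation that contains the connections of `q` and of `p`. -/
def stack {k l m : ℕ} (p : PointPartition l m) (q : PointPartition k l) :
    Setoid (Fin k ⊕ Fin l ⊕ Fin m) :=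
  Setoid.map q (Sum.map id Sum.inl) ⊔ Setoid.map p Sum.inr

/-- The composition `p q`: place `q` above `p`, identify the lower points of `q` with the upper points
of `p`, and remove the points of the middle row. -/
def comp {k l m : ℕ} (p : PointPartition l m) (q : PointPartition k l) : PointPartition k m :=
  Setoid.comap (Sum.map id Sum.inr) (stack p q)

/-- The identity partition: one block with one upper and one lower point. -/
def identity : PointPartition 1 1 := ⊤

/-- The pair partition: one block with two lower points. -/
def pair : PointPartition 0 2 := ⊤

/-- The partition `p(i₁, …, iₙ)` with `n` lower points, where the `s`-th and the `t`-th point are in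
the same block if and only if `iₛ = iₜ`. -/
def ofIndices {n : ℕ} (i : Fin n → ℕ) : PointPartition 0 n :=
  Setoid.ker (Sum.elim Fin.elim0 i)

/-- The triple `c = (k, l, b)` represents the partition `p`: `b` is a list of `k + l` block labels,
first those of the upper points and then those of the lower points, both from left to right, and
two points are in the same block of `p` if and only if their labels are equal. -/
def IsRepresentedBy {k l : ℕ} (p : PointPartition k l) (c : ℕ × ℕ × List ℕ) : Prop :=
  c.1 = k ∧ c.2.1 = l ∧ c.2.2.length = k + l ∧
    p = Setoid.ker (fun x : Fin k ⊕ Fin l => c.2.2[(finSumFinEquiv x : ℕ)]?)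

end PointPartition

/-- A category of partitions: `carrier k l` is the set `C(k, l)` of those elements of the category
that have `k` upper and `l` lower points. -/
structure PartitionCategory where
  carrier : ∀ k l : ℕ, Set (PointPartition k l)
  identity_mem : PointPartition.identity ∈ carrier 1 1
  pair_mem : PointPartition.pair ∈ carrier 0 2
  tensor_mem : ∀ {k₁ l₁ k₂ l₂ : ℕ} {p : PointPartition k₁ l₁} {q : PointPartition k₂ l₂},
    p ∈ carrier k₁ l₁ → q ∈ carrier k₂ l₂ → p.tensor q ∈ carrier (k₁ + k₂) (l₁ + l₂)
  involution_mem : ∀ {k l : ℕ} {p : PointPartition k l},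
    p ∈ carrier k l → p.involution ∈ carrier l k
  comp_mem : ∀ {k l m : ℕ} {p : PointPartition l m} {q : PointPartition k l},
    p ∈ carrier l m → q ∈ carrier k l → p.comp q ∈ carrier k m

/-- A category of partitions is recursively enumerable if its elements can be enumerated by an
algorithm: some computable sequence of triples `(k, l, b)` lists representations of elements of the
category only, and of all of them. -/
def PartitionCategory.IsRecursivelyEnumerable (C : PartitionCategory) : Prop :=
  ∃ f : ℕ → ℕ × ℕ × List ℕ, Computable f ∧
    (∀ n, ∃ k l : ℕ, ∃ p ∈ C.carrier k l, p.IsRepresentedBy (f n)) ∧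
    ∀ k l : ℕ, ∀ p ∈ C.carrier k l, ∃ n, p.IsRepresentedBy (f n)

namespace GroupVariety

/-- The word `w` in the variables `x₀, x₁, …` is an identity in the group `G`: every substitution of
elements of `G` for the variables gives `1`. -/
def IsIdentityIn (w : FreeGroup ℕ) (G : Type u) [Group G] : Prop :=
  ∀ g : ℕ → G, FreeGroup.lift g w = 1

/-- The variety defined by `W`: the class of all groups in which all words of `W` are identities. -/
def variety (W : Set (FreeGroup ℕ)) : Set GrpCat.{u} :=
  {G | ∀ w ∈ W, IsIdentityIn w G}

/-- A class of groups is a finitely based variety if it is defined by a finite set of words. -/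
def IsFinitelyBasedVariety (V : Set GrpCat.{u}) : Prop :=
  ∃ W : Set (FreeGroup ℕ), W.Finite ∧ V = variety W

/-- The word `w` is an identity in all members of the class `V`. -/
def IsIdentityOf (w : FreeGroup ℕ) (V : Set GrpCat.{u}) : Prop :=
  ∀ G ∈ V, IsIdentityIn w G

end GroupVariety

namespace Involutions

/-- The free product of countably many copies of the group with two elements. -/
abbrev FreeProduct : Type := Monoid.CoprodI (fun _ : ℕ => Multiplicative (ZMod 2))

/-- The canonical generators `a₀, a₁, …`. -/
def a (i : ℕ) : FreeProduct :=
  Monoid.CoprodI.of (M := fun _ : ℕ => Multiplicative (ZMod 2)) (i := i) (Multiplicative.ofAdd 1)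

/-- The product `a_{i₁} ⋯ a_{iₙ}`. -/
def wordProd {n : ℕ} (i : Fin n → ℕ) : FreeProduct :=
  (List.ofFn fun t => a (i t)).prod

/-- The embedding of the free group on `x₀, x₁, …` into the free product with `xₙ ↦ a₀ aₙ₊₁`, which is
an isomorphism onto the subgroup of all words of even length. -/
def embedding : FreeGroup ℕ →* FreeProduct :=
  FreeGroup.lift fun n => a 0 * a (n + 1)

theorem a_inv (i : ℕ) : (a i)⁻¹ = a i := by
  rw [a, ← map_inv]
  rfl

/-- The spelling of a word of the free group in the generators `aᵢ`, letter by letter: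
`xₙ` becomes `a₀ aₙ₊₁` and `xₙ⁻¹` becomes `aₙ₊₁ a₀`. -/
def spell (w : FreeGroup ℕ) : List ℕ :=
  w.toWord.flatMap fun x => if x.2 then [0, x.1 + 1] else [x.1 + 1, 0]

/-- Every word has an expression by a sequence of indices: the letter-by-letter spelling gives a sequence of indices whose product is the image of the word. -/
theorem wordProd_spell (w : FreeGroup ℕ) : wordProd (spell w).get = embedding w := by
  have key : ∀ L : List (ℕ × Bool),
      ((L.flatMap fun x => if x.2 then [0, x.1 + 1] else [x.1 + 1, 0]).map a).prod =
        embedding (FreeGroup.mk L) := by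
    intro L
    induction L with
    | nil => simp [embedding]
    | cons x L ih =>
      obtain ⟨n, b⟩ := x
      rw [List.flatMap_cons, List.map_append, List.prod_append, ih]
      cases b <;> simp [embedding, a_inv]
  have h := key w.toWord
  rw [FreeGroup.mk_toWord] at h
  rw [← h]
  change (List.ofFn (a ∘ (spell w).get)).prod = ((spell w).map a).prod
  rw [← List.map_ofFn, List.ofFn_get]

end Involutions

/-!
Along a sequence of group elements take the alternating product `x₁⁻¹ x₂ x₃⁻¹ ⋯`. A partition
belongs to the category of a class `V` of groups if its number of points is even and, whenever its points
are labelled by elements of a group in `V` so that labels are constant on blocks, the alternating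
products of the two rows agree. This is a category of partitions: for compositions a labelling is
extended to the middle row (`PointPartition.holdsIn_comp`); in a tensor product whose left factor
has rows of odd length, the signs along the right factor are reversed, which is absorbed by
inverting the labels there (`PointPartition.holdsIn_tensor`).

The category detects identities because of a double cover: two copies of a group `G` are
interchanged by the involutions "multiply by `gᵢ` in one direction and by `gᵢ⁻¹` in the other", so
the free product of the groups of order two acts on them. A product `a_{i₁} ⋯ a_{iₙ}` of even length
acts on one sheet by the alternating product of `g_{i₁}, …, g_{iₙ}`, while the image of a word `w`
acts by the value of `w` at the elements `g₀⁻¹ gₙ₊₁` (`Involutions.altProd_of_wordProd_eq`). With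
`g₀ = 1` all substitutions into `w` arise, whichever expression of the image of `w` is chosen.

For a class given by finitely many words, membership of a labelled partition says that a word
computed from the labels is an identity of the variety. By Birkhoff's argument, the identities are
the products of conjugates of substitution instances of the defining words and of their inverses
(`GroupVariety.isIdentityOf_variety_iff`). The data of such a product is a finite certificate, and
checking it is primitive recursive because free reduction is, so that running through all pairs of
labels and certificates enumerates the category (`partitionCategory_isRecursivelyEnumerable`).
-/

/-! ### Alternating products -/

/-- The alternating product `x₁⁻¹ x₂ x₃⁻¹ x₄ ⋯` of a list of group elements. -/
def altProd {G : Type*} [Group G] : List G → G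
  | [] => 1
  | x :: L => x⁻¹ * (altProd (L.map (·⁻¹)))
termination_by L => L.length

section altProd

variable {G : Type*} [Group G]

@[simp]
theorem altProd_nil : altProd ([] : List G) = 1 := by
  rw [altProd]

theorem altProd_cons (x : G) (L : List G) :
    altProd (x :: L) = x⁻¹ * altProd (L.map (·⁻¹)) := by
  rw [altProd]

/-- In a concatenation, the signs of the second factor are shifted if the first has odd length. -/
theorem altProd_append (L M : List G) :
    altProd (L ++ M) =
      altProd L * altProd (if Even L.length then M else M.map (·⁻¹)) := by
  induction hn : L.length generalizing L M with
  | zero => simp [List.length_eq_zero_iff.1 hn]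
  | succ n ih =>
    obtain ⟨x, L, rfl⟩ := List.exists_cons_of_length_eq_add_one hn
    have hL : (L.map (·⁻¹)).length = n := by simpa using hn
    rw [List.cons_append, altProd_cons, List.map_append, ih _ _ hL, altProd_cons, mul_assoc]
    by_cases h : Even n <;> simp [h, Nat.even_add_one]

theorem map_altProd {H F : Type*} [Group H] [FunLike F G H] [MonoidHomClass F G H]
    (f : F) (L : List G) : f (altProd L) = altProd (L.map f) := by
  induction hn : L.length generalizing L with
  | zero => simp [List.length_eq_zero_iff.1 hn]
  | succ n ih =>
    obtain ⟨x, L, rfl⟩ := List.exists_cons_of_length_eq_add_one hn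
    have hL : (L.map (·⁻¹)).length = n := by simpa using hn
    rw [List.map_cons, altProd_cons, altProd_cons, map_mul, map_inv, ih _ hL]
    simp [Function.comp_def]

end altProd

/-! ### The category of partitions of a class of groups -/

namespace PointPartition

variable {G : Type*} [Group G]

/-- The labelling `b` of the points of a partition by group elements is balanced if the
alternating products of the labels of the upper row and of the lower row agree. -/
def Balanced {k l : ℕ} (b : Fin k ⊕ Fin l → G) : Prop :=
  altProd (List.ofFn fun i => b (Sum.inl i)) = altProd (List.ofFn fun j => b (Sum.inr j))

/-- The partition `p` holds in the group `G` if every labelling of its points by elements of `G`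
that is constant on the blocks of `p` is balanced. -/
def HoldsIn {k l : ℕ} (p : PointPartition k l) (G : Type*) [Group G] : Prop :=
  ∀ b : Fin k ⊕ Fin l → G, p ≤ Setoid.ker b → Balanced b

theorem holdsIn_identity : identity.HoldsIn G := by
  intro b hb
  have h : b (Sum.inl 0) = b (Sum.inr 0) := hb (show identity _ _ from trivial)
  simp [Balanced, altProd_cons, h]

theorem holdsIn_pair : pair.HoldsIn G := by
  intro b hb
  have h : b (Sum.inr 0) = b (Sum.inr 1) := hb (show PointPartition.pair _ _ from trivial)
  simp [Balanced, altProd_cons, h]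

theorem holdsIn_involution {k l : ℕ} {p : PointPartition k l} (hp : p.HoldsIn G) :
    p.involution.HoldsIn G := by
  intro b hb
  refine (hp (b ∘ Sum.swap) fun x y hxy => hb (?_ : p x.swap.swap y.swap.swap)).symm
  simpa using hxy

theorem holdsIn_tensor {k₁ l₁ k₂ l₂ : ℕ} {p : PointPartition k₁ l₁} {q : PointPartition k₂ l₂}
    (hp : p.HoldsIn G) (hq : q.HoldsIn G) (h : Even k₁ ↔ Even l₁) : (p.tensor q).HoldsIn G := by
  intro b hb
  set e := ((Equiv.sumSumSumComm (Fin k₁) (Fin l₁) (Fin k₂) (Fin l₂)).trans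
      (Equiv.sumCongr finSumFinEquiv finSumFinEquiv)) with he
  have h₁ : p ≤ Setoid.ker fun x => b (e (Sum.inl x)) := fun x y hxy => by
    refine hb ?_
    change disjointSum p q (e.symm _) (e.symm _)
    rw [e.symm_apply_apply, e.symm_apply_apply]
    exact Sum.LiftRel.inl hxy
  have h₂ : q ≤ Setoid.ker fun x => b (e (Sum.inr x)) := fun x y hxy => by
    refine hb ?_
    change disjointSum p q (e.symm _) (e.symm _)
    rw [e.symm_apply_apply, e.symm_apply_apply]
    exact Sum.LiftRel.inr hxy
  have h₃ : q ≤ Setoid.ker fun x => (b (e (Sum.inr x)))⁻¹ := fun x y hxy =>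
    congrArg (·⁻¹) (h₂ hxy)
  have H₁ := hp _ h₁
  have H₂ := hq _ h₂
  have H₃ := hq _ h₃
  simp only [Balanced, he] at H₁ H₂ H₃ ⊢
  simp only [Equiv.trans_apply, Equiv.sumSumSumComm_apply, Equiv.sumCongr_apply] at H₁ H₂ H₃
  rw [List.ofFn_add, List.ofFn_add, altProd_append, altProd_append]
  by_cases hk : Even k₁
  · simpa [hk, h.1 hk, Fin.castAdd] using congrArg₂ (· * ·) H₁ H₂
  · have hl : ¬ Even l₁ := fun hl => hk (h.2 hl)
    simpa [hk, hl, Fin.castAdd, List.map_ofFn, Function.comp_def] using congrArg₂ (· * ·) H₁ H₃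

theorem holdsIn_comp {k l m : ℕ} {p : PointPartition l m} {q : PointPartition k l}
    (hp : p.HoldsIn G) (hq : q.HoldsIn G) : (p.comp q).HoldsIn G := by
  classical
  intro b hb
  -- The labels extend to the middle row, along the blocks of the stacked diagram.
  let ι : Fin k ⊕ Fin m → Fin k ⊕ Fin l ⊕ Fin m := Sum.map id Sum.inr
  let c : Fin k ⊕ Fin l ⊕ Fin m → G := fun z =>
    if h : ∃ x, stack p q (ι x) z then b h.choose else 1
  have hc : ∀ z z', stack p q z z' → c z = c z' := by
    intro z z' hz
    by_cases h : ∃ x, stack p q (ι x) z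
    · have h' : ∃ x, stack p q (ι x) z' := ⟨h.choose, (stack p q).trans h.choose_spec hz⟩
      simp only [c, dif_pos h, dif_pos h']
      exact hb ((stack p q).trans ((stack p q).trans h.choose_spec hz)
        ((stack p q).symm h'.choose_spec))
    · have h' : ¬ ∃ x, stack p q (ι x) z' := fun ⟨x, hx⟩ =>
        h ⟨x, (stack p q).trans hx ((stack p q).symm hz)⟩
      simp only [c, dif_neg h, dif_neg h']
  have hcb : ∀ x, c (ι x) = b x := by
    intro x
    have h : ∃ y, stack p q (ι y) (ι x) := ⟨x, (stack p q).refl _⟩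
    simp only [c, dif_pos h]
    exact hb h.choose_spec
  have h₁ : q ≤ Setoid.ker fun x => c (Sum.map id Sum.inl x) := fun x y hxy => by
    refine hc _ _ ((le_sup_left : _ ≤ stack p q) ?_)
    exact Relation.EqvGen.rel _ _ ⟨x, y, hxy, rfl, rfl⟩
  have h₂ : p ≤ Setoid.ker fun x => c (Sum.inr x) := fun x y hxy => by
    refine hc _ _ ((le_sup_right : _ ≤ stack p q) ?_)
    exact Relation.EqvGen.rel _ _ ⟨x, y, hxy, rfl, rfl⟩
  have H : ∀ b', b' = b → Balanced (G := G) b' → Balanced b := fun _ h => h ▸ id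
  exact H (fun x => c (ι x)) (funext hcb) ((hq _ h₁).trans (hp _ h₂))

/-- It suffices to test labellings that factor through a fixed sequence of block labels. -/
theorem holdsIn_ker_iff {k l : ℕ} (i : Fin k ⊕ Fin l → ℕ) :
    HoldsIn (Setoid.ker i) G ↔ ∀ g : ℕ → G, Balanced (g ∘ i) := by
  refine ⟨fun h g => h _ fun x y hxy => congrArg g hxy, fun h b hb => ?_⟩
  have : Function.extend i b 1 ∘ i = b := by
    funext x
    exact Function.FactorsThrough.extend_apply (fun x y hxy => hb hxy) _ x
  exact this ▸ h (Function.extend i b 1)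

end PointPartition

open PointPartition in
/-- The category of partitions of a class `V` of groups: the partitions that have points of even
number in total and hold in all members of `V`. -/
def partitionCategory (V : Set GrpCat.{u}) : PartitionCategory where
  carrier k l := {p | (Even k ↔ Even l) ∧ ∀ G ∈ V, p.HoldsIn G}
  identity_mem := ⟨Iff.rfl, fun _ _ => holdsIn_identity⟩
  pair_mem := ⟨by decide, fun _ _ => holdsIn_pair⟩
  tensor_mem hp hq := ⟨by simp only [Nat.even_add, hp.1, hq.1],
    fun G hG => holdsIn_tensor (hp.2 G hG) (hq.2 G hG) hp.1⟩
  involution_mem hp := ⟨hp.1.symm, fun G hG => holdsIn_involution (hp.2 G hG)⟩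
  comp_mem hp hq := ⟨hq.1.trans hp.1, fun G hG => holdsIn_comp (hp.2 G hG) (hq.2 G hG)⟩

/-! ### Expressions in the generators of the free product -/

namespace Involutions

variable {G : Type*} [Group G]

/-- The homomorphism from the group with two elements determined by an involution. -/
def homOfInvolution {K : Type*} [Group K] (s : K) (hs : s * s = 1) :
    Multiplicative (ZMod 2) →* K :=
  AddMonoidHom.toMultiplicativeLeft (ZMod.lift 2
    ⟨zmultiplesHom (Additive K) (Additive.ofMul s), by
      change Additive.ofMul (s ^ (2 : ℤ)) = 0
      rw [zpow_two, hs]; rfl⟩)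

theorem homOfInvolution_ofAdd_one {K : Type*} [Group K] (s : K) (hs : s * s = 1) :
    homOfInvolution s hs (Multiplicative.ofAdd 1) = s := by
  change Additive.toMul (ZMod.lift 2 _ (1 : ZMod 2)) = s
  have := ZMod.lift_coe 2 (⟨zmultiplesHom (Additive K) (Additive.ofMul s), by
      change Additive.ofMul (s ^ (2 : ℤ)) = 0
      rw [zpow_two, hs]; rfl⟩ : {f : ℤ →+ Additive K // f (2 : ℕ) = 0}) 1
  rw [Int.cast_one] at this
  rw [this]
  simp

/-- Two copies of `G`, the sheets of a double cover, are interchanged by left multiplication with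
`x` in one direction and with `x⁻¹` in the other. -/
def swapSheets (x : G) : Equiv.Perm (G × Bool) :=
  Function.Involutive.toPerm (fun z => (bif z.2 then x * z.1 else x⁻¹ * z.1, !z.2)) (by
    rintro ⟨h, _ | _⟩ <;> simp)

theorem swapSheets_true (x h : G) : swapSheets x (h, true) = (x * h, false) := rfl

theorem swapSheets_false (x h : G) : swapSheets x (h, false) = (x⁻¹ * h, true) := rfl

theorem swapSheets_mul_self (x : G) : swapSheets x * swapSheets x = 1 := by
  ext1 z
  exact (swapSheets x).symm_apply_apply z

/-- The action of the free product on the double cover of `G` in which the generator `aᵢ`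
interchanges the sheets by means of `gᵢ`. -/
def sheetAction (g : ℕ → G) : FreeProduct →* Equiv.Perm (G × Bool) :=
  Monoid.CoprodI.lift fun i => homOfInvolution (swapSheets (g i)) (swapSheets_mul_self _)

theorem sheetAction_a (g : ℕ → G) (i : ℕ) : sheetAction g (a i) = swapSheets (g i) := by
  rw [sheetAction, a, Monoid.CoprodI.lift_of, homOfInvolution_ofAdd_one]

theorem sheetAction_prod (g : ℕ → G) (L : List ℕ) :
    sheetAction g (L.map a).prod (1, true) =
      if Even L.length then (altProd (L.map g), true)
      else (altProd ((L.map g).map (·⁻¹)), false) := by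
  induction L with
  | nil => simp
  | cons i L ih =>
    rw [List.map_cons, List.prod_cons, map_mul, Equiv.Perm.mul_apply, ih, sheetAction_a]
    by_cases h : Even L.length
    · simp [h, Nat.even_add_one, swapSheets_true, altProd_cons, Function.comp_def]
    · simp [h, Nat.even_add_one, swapSheets_false, altProd_cons]

theorem sheetAction_embedding (g : ℕ → G) (w : FreeGroup ℕ) (h : G) :
    sheetAction g (embedding w) (h, true) =
      (FreeGroup.lift (fun n => (g 0)⁻¹ * g (n + 1)) w * h, true) := by
  induction w using FreeGroup.induction_on generalizing h with
  | C1 => simp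
  | of n =>
    simp [embedding, sheetAction_a, swapSheets_true, swapSheets_false, mul_assoc]
  | inv_of n ih =>
    rw [map_inv, map_inv, Equiv.Perm.inv_eq_iff_eq, ih]
    simp [mul_assoc]
  | mul v w hv hw =>
    simp [hw, hv, mul_assoc]

/-- If a sequence of indices expresses the image of `w`, then the alternating products along the
sequence are values of `w`, and the length of the sequence is even. -/
theorem altProd_of_wordProd_eq {w : FreeGroup ℕ} {n : ℕ} {i : Fin n → ℕ}
    (h : wordProd i = embedding w) (g : ℕ → G) :
    Even n ∧ altProd (List.ofFn (g ∘ i)) =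
      FreeGroup.lift (fun n => (g 0)⁻¹ * g (n + 1)) w := by
  have h₁ := sheetAction_embedding g w 1
  have h₂ := sheetAction_prod g (List.ofFn i)
  rw [List.map_ofFn] at h₂
  rw [← h, wordProd, show (fun t => a (i t)) = a ∘ i from rfl, h₂, List.length_ofFn] at h₁
  by_cases hn : Even n
  · simpa [hn, List.map_ofFn] using h₁
  · simp [hn] at h₁

end Involutions

open Involutions GroupVariety PointPartition in
/-- The category of `V` detects the identities of `V`. This needs no finite basis. -/
theorem isIdentityOf_iff_ofIndices_mem (V : Set GrpCat.{u}) {w : FreeGroup ℕ} {n : ℕ}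
    {i : Fin n → ℕ} (h : wordProd i = embedding w) :
    IsIdentityOf w V ↔ ofIndices i ∈ (partitionCategory V).carrier 0 n := by
  have hn : Even n := (altProd_of_wordProd_eq h (1 : ℕ → Unit)).1
  have key : ∀ (G : Type u) [Group G], IsIdentityIn w G ↔ (ofIndices i).HoldsIn G := by
    intro G _
    rw [ofIndices, holdsIn_ker_iff]
    have hb : ∀ g : ℕ → G, Balanced (g ∘ Sum.elim Fin.elim0 i : Fin 0 ⊕ Fin n → G) ↔
        FreeGroup.lift (fun n => (g 0)⁻¹ * g (n + 1)) w = 1 := fun g => by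
      rw [← (altProd_of_wordProd_eq h g).2, eq_comm]
      simp [PointPartition.Balanced, Function.comp_def]
    refine ⟨fun H g => (hb g).2 (H _), fun H g => ?_⟩
    -- Any substitution `g` arises from the labels `1, g₀, g₁, …`.
    simpa using (hb fun m => m.casesOn 1 g).1 (H _)
  exact ⟨fun H => ⟨by simpa using hn, fun G hG => (key G).1 (H G hG)⟩,
    fun H G hG => (key G).2 (H.2 G hG)⟩

/-! ### Consequences of a list of words -/

namespace FreeGroup

/-- The word `x_{i₁}⁻¹ x_{i₂} x_{i₃}⁻¹ ⋯` as a list of letters with signs. -/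
def altWord (L : List ℕ) : List (ℕ × Bool) :=
  L.foldr (fun n M => (n, false) :: M.map fun x => (x.1, !x.2)) []

theorem mk_map_not (L : List (ℕ × Bool)) :
    mk (L.map fun x => (x.1, !x.2)) = lift (fun n => (of n)⁻¹) (mk L) := by
  rw [← lift_of_apply (mk _), lift_mk, lift_mk, List.map_map]
  congr 2
  funext ⟨n, s⟩
  cases s <;> simp

theorem mk_altWord (L : List ℕ) : mk (altWord L) = altProd (L.map of) := by
  induction L with
  | nil => simp [altWord, one_eq_mk]
  | cons n L ih =>
    have h : altWord (n :: L) = [(n, false)] ++ (altWord L).map fun x => (x.1, !x.2) := rfl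
    rw [h, ← mul_mk, mk_map_not, ih, List.map_cons, altProd_cons, map_altProd]
    congr 2
    simp [Function.comp_def]

/-- The substitution of the words of the list `θ` for the variables. Variables beyond the end of
the list are replaced by the empty word. -/
def substWord (θ : List (List (ℕ × Bool))) (L : List (ℕ × Bool)) : List (ℕ × Bool) :=
  L.flatMap fun x => bif x.2 then θ.getD x.1 [] else invRev (θ.getD x.1 [])

theorem mk_substWord (θ : List (List (ℕ × Bool))) (L : List (ℕ × Bool)) :
    mk (substWord θ L) = lift (fun n => mk (θ.getD n [])) (mk L) := by
  induction L with
  | nil => simp [substWord, ← one_eq_mk]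
  | cons x L ih =>
    obtain ⟨n, s⟩ := x
    have h : substWord θ ((n, s) :: L) =
      (bif s then θ.getD n [] else invRev (θ.getD n [])) ++ substWord θ L := rfl
    rw [h, ← mul_mk, ih, lift_mk, lift_mk]
    cases s <;> simp [inv_mk]

/-- The data of a conjugate `g θ(r)^{±1} g⁻¹` of a substitution instance of a word `r` from a list:
the word `g`, the substitution `θ`, the index of `r` in the list, and the sign. -/
abbrev ConjCode : Type := List (ℕ × Bool) × List (List (ℕ × Bool)) × ℕ × Bool

/-- The conjugate `g θ(r)^{±1} g⁻¹` that is encoded by `x`, where `r` is taken from `R`. -/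
def conjWord (R : List (List (ℕ × Bool))) (x : ConjCode) : List (ℕ × Bool) :=
  x.1 ++ (substWord x.2.1 (bif x.2.2.2 then R.getD x.2.2.1 [] else invRev (R.getD x.2.2.1 [])) ++
    invRev x.1)

/-- The product of the conjugates that are encoded by the members of the list `c`. -/
def consequence (R : List (List (ℕ × Bool))) (c : List ConjCode) : List (ℕ × Bool) :=
  c.flatMap (conjWord R)

variable (R : List (List (ℕ × Bool)))

theorem mk_conjWord (x : ConjCode) : mk (conjWord R x) =
    mk x.1 * lift (fun n => mk (x.2.1.getD n []))
      (bif x.2.2.2 then mk (R.getD x.2.2.1 []) else (mk (R.getD x.2.2.1 []))⁻¹) * (mk x.1)⁻¹ := by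
  rw [conjWord, ← mul_mk, ← mul_mk, mk_substWord, inv_mk, inv_mk, mul_assoc]
  cases x.2.2.2 <;> rfl

theorem mk_consequence (c : List ConjCode) :
    mk (consequence R c) = (c.map fun x => mk (conjWord R x)).prod := by
  induction c with
  | nil => rfl
  | cons x c ih => rw [List.map_cons, List.prod_cons, ← ih, mul_mk]; rfl

theorem mk_conjWord_inv (x : ConjCode) :
    (mk (conjWord R x))⁻¹ = mk (conjWord R (x.1, x.2.1, x.2.2.1, !x.2.2.2)) := by
  rw [mk_conjWord, mk_conjWord]
  cases x.2.2.2 <;> simp [mul_assoc, -inv_mk, -lift_mk]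

/-- The subgroup of all consequences of the words of `R`, the verbal subgroup for these words. -/
def consequences : Subgroup (FreeGroup ℕ) where
  carrier := Set.range fun c => mk (consequence R c)
  one_mem' := ⟨[], rfl⟩
  mul_mem' := by
    rintro _ _ ⟨c, rfl⟩ ⟨d, rfl⟩
    exact ⟨c ++ d, by simp [mk_consequence]⟩
  inv_mem' := by
    rintro _ ⟨c, rfl⟩
    refine ⟨(c.map fun x => (x.1, x.2.1, x.2.2.1, !x.2.2.2)).reverse, ?_⟩
    simp only [mk_consequence, List.prod_inv_reverse, List.map_map, List.map_reverse,
      Function.comp_def, mk_conjWord_inv]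

theorem mem_consequences {w : FreeGroup ℕ} :
    w ∈ consequences R ↔ ∃ c, mk (consequence R c) = w := Iff.rfl

instance consequences_normal : (consequences R).Normal where
  conj_mem := by
    rintro _ ⟨c, rfl⟩ g
    refine ⟨c.map fun x => (g.toWord ++ x.1, x.2), ?_⟩
    simp only [mk_consequence, List.map_map]
    induction c with
    | nil => simp
    | cons x c ih =>
      rw [List.map_cons, List.prod_cons, ih, List.map_cons, List.prod_cons]
      simp [mk_conjWord, ← mul_mk, mk_toWord, mul_assoc, -inv_mk, -lift_mk]

theorem exists_forall_fst_lt (L : List (ℕ × Bool)) : ∃ M, ∀ x ∈ L, x.1 < M := by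
  induction L with
  | nil => exact ⟨0, by simp⟩
  | cons x L ih =>
    obtain ⟨M, hM⟩ := ih
    refine ⟨max M (x.1 + 1), fun y hy => ?_⟩
    rcases List.mem_cons.1 hy with rfl | hy
    · omega
    · exact lt_max_of_lt_left (hM y hy)

theorem lift_mem_consequences {r : List (ℕ × Bool)} (hr : r ∈ R) (θ : ℕ → FreeGroup ℕ) :
    lift θ (mk r) ∈ consequences R := by
  obtain ⟨j, hj, rfl⟩ := List.mem_iff_getElem.1 hr
  obtain ⟨M, hM⟩ := exists_forall_fst_lt R[j]
  -- Only the finitely many variables that occur in the word matter for the substitution.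
  refine ⟨[([], (List.range M).map fun n => (θ n).toWord, j, true)], ?_⟩
  simp only [mk_consequence, List.map_cons, List.map_nil, List.prod_singleton, mk_conjWord,
    cond_true, ← one_eq_mk, one_mul, inv_one, mul_one, List.getD_eq_getElem _ _ hj, lift_mk]
  congr 1
  refine List.map_congr_left fun x hx => ?_
  have := hM x hx
  simp [this, mk_toWord]

end FreeGroup

namespace GroupVariety

open FreeGroup

/-- A word is an identity of a finitely based variety if and only if it is a consequence of the
defining words: the quotient by the consequences is a group of the variety. -/
theorem isIdentityOf_variety_iff (R : List (List (ℕ × Bool))) (w : FreeGroup ℕ) :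
    IsIdentityOf w (variety.{u} {r | ∃ L ∈ R, mk L = r}) ↔ w ∈ consequences R := by
  constructor
  · intro h
    let Q := FreeGroup ℕ ⧸ consequences R
    have hQ : GrpCat.of (ULift.{u} Q) ∈ variety.{u} {r | ∃ L ∈ R, mk L = r} := by
      rintro _ ⟨r, hr, rfl⟩ g
      have hg : lift g = (MulEquiv.ulift.symm.toMonoidHom.comp
          (QuotientGroup.mk' (consequences R))).comp (lift fun n => (g n).down.out) := by
        refine FreeGroup.ext_hom _ _ fun n => ?_
        simp only [lift_apply_of, MonoidHom.comp_apply]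
        exact congrArg ULift.up (Quotient.out_eq (g n).down).symm
      rw [hg, MonoidHom.comp_apply, MonoidHom.comp_apply, QuotientGroup.mk'_apply,
        (QuotientGroup.eq_one_iff _).2 (lift_mem_consequences R hr _), _root_.map_one]
    have h₁ := h _ hQ fun n => ULift.up (QuotientGroup.mk' (consequences R) (of n))
    have hg : lift (fun n => (ULift.up (QuotientGroup.mk' (consequences R) (of n)) : ULift.{u} Q)) =
        MulEquiv.ulift.symm.toMonoidHom.comp (QuotientGroup.mk' (consequences R)) :=
      FreeGroup.ext_hom _ _ fun n => lift_apply_of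
    rw [← QuotientGroup.eq_one_iff]
    exact congrArg ULift.down ((DFunLike.congr_fun hg w).symm.trans h₁)
  · rintro ⟨c, rfl⟩ G hG g
    have key : ∀ r ∈ R, ∀ θ : ℕ → FreeGroup ℕ, lift g (lift θ (mk r)) = 1 := by
      intro r hr θ
      have : (lift g).comp (lift θ) = lift fun n => lift g (θ n) :=
        FreeGroup.ext_hom _ _ fun n => by simp
      rw [← MonoidHom.comp_apply, this]
      exact hG _ ⟨r, hr, rfl⟩ _
    have key' : ∀ j, ∀ θ : ℕ → FreeGroup ℕ, lift g (lift θ (mk (R.getD j []))) = 1 := by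
      intro j θ
      by_cases hj : j < R.length
      · rw [List.getD_eq_getElem _ _ hj]
        exact key _ (List.getElem_mem hj) θ
      · rw [List.getD_eq_default _ _ (not_lt.1 hj), ← one_eq_mk, _root_.map_one, _root_.map_one]
    change lift g (mk (consequence R c)) = 1
    rw [mk_consequence, map_list_prod, List.map_map]
    refine List.prod_eq_one fun y hy => ?_
    obtain ⟨x, -, rfl⟩ := List.mem_map.1 hy
    rw [Function.comp_apply, mk_conjWord]
    cases x.2.2.2 <;> simp [key', -inv_mk, -lift_mk, -List.getD_eq_getElem?_getD]

end GroupVariety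

/-! ### Enumeration of the category -/

namespace PointPartition

theorem exists_isRepresentedBy {k l : ℕ} (p : PointPartition k l) :
    ∃ b : List ℕ, p.IsRepresentedBy (k, l, b) := by
  -- Each point is labelled with the position of the chosen representative of its block.
  let i : Fin k ⊕ Fin l → ℕ := fun x => finSumFinEquiv (Quotient.mk p x).out
  refine ⟨List.ofFn fun j => i (finSumFinEquiv.symm j), rfl, rfl, by simp, ?_⟩
  ext x y
  have h : ∀ z : Fin k ⊕ Fin l,
      (List.ofFn fun j => i (finSumFinEquiv.symm j))[(finSumFinEquiv z : ℕ)]? = some (i z) := by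
    intro z
    rw [List.getElem?_ofFn, dif_pos (finSumFinEquiv z).isLt]
    simp
  rw [Setoid.ker_def, h, h, Option.some_inj, Fin.val_inj, finSumFinEquiv.apply_eq_iff_eq,
    Quotient.out_inj, Quotient.eq]

open GroupVariety FreeGroup in
/-- For a partition given by labels, membership in the category of `V` amounts to one word being
an identity of `V`. -/
theorem mem_partitionCategory_iff (V : Set GrpCat.{u}) {k l : ℕ} {b : List ℕ}
    (hb : b.length = k + l) :
    Setoid.ker (fun x : Fin k ⊕ Fin l => b[(finSumFinEquiv x : ℕ)]?) ∈
        (partitionCategory V).carrier k l ↔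
      (Even k ↔ Even l) ∧
        IsIdentityOf ((mk (altWord (b.drop k)))⁻¹ * mk (altWord (b.take k))) V := by
  have hker : Setoid.ker (fun x : Fin k ⊕ Fin l => b[(finSumFinEquiv x : ℕ)]?) =
      Setoid.ker fun x : Fin k ⊕ Fin l => b.getD (finSumFinEquiv x) 0 := by
    ext x y
    have h : ∀ z : Fin k ⊕ Fin l,
        b[(finSumFinEquiv z : ℕ)]? = some (b.getD (finSumFinEquiv z) 0) := fun z => by
      have := (finSumFinEquiv z).isLt
      rw [List.getD_eq_getElem _ _ (by omega), List.getElem?_eq_getElem]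
    rw [Setoid.ker_def, Setoid.ker_def, h, h, Option.some_inj]
  have key : ∀ (G : Type u) [Group G],
      HoldsIn (Setoid.ker fun x : Fin k ⊕ Fin l => b.getD (finSumFinEquiv x) 0) G ↔
        IsIdentityIn ((mk (altWord (b.drop k)))⁻¹ * mk (altWord (b.take k))) G := by
    intro G _
    rw [holdsIn_ker_iff]
    refine forall_congr' fun g => ?_
    have h₁ : (List.ofFn fun i : Fin k =>
        (g ∘ fun x : Fin k ⊕ Fin l => b.getD (finSumFinEquiv x) 0) (Sum.inl i)) =
        (b.take k).map g := by
      refine List.ext_getElem (by simp [hb]) fun n hn _ => ?_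
      have : n < b.length := by simp at hn; omega
      simp [this]
    have h₂ : (List.ofFn fun j : Fin l =>
        (g ∘ fun x : Fin k ⊕ Fin l => b.getD (finSumFinEquiv x) 0) (Sum.inr j)) =
        (b.drop k).map g := by
      refine List.ext_getElem (by simp [hb]) fun n hn _ => ?_
      have : k + n < b.length := by simp at hn; omega
      simp [this]
    rw [Balanced, h₁, h₂, _root_.map_mul, _root_.map_inv, inv_mul_eq_one, mk_altWord,
      mk_altWord, map_altProd, map_altProd, eq_comm]
    simp [Function.comp_def]
  rw [hker]
  exact and_congr_right fun _ => forall₂_congr fun G _ => key G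

end PointPartition

namespace FreeGroup

theorem primrec_altWord : Primrec altWord := by
  refine Primrec.list_foldr
    (h := fun (_ : List ℕ) (x : ℕ × List (ℕ × Bool)) =>
      (x.1, false) :: x.2.map fun y => (y.1, !y.2))
    Primrec.id (Primrec.const []) ?_
  refine Primrec.list_cons.comp
    ((Primrec.fst.comp Primrec.snd).pair (Primrec.const false)) ?_
  exact Primrec.list_map (Primrec.snd.comp Primrec.snd)
    ((Primrec.fst.comp Primrec.snd).pair (Primrec.not.comp (Primrec.snd.comp Primrec.snd)))

theorem primrec_invRev : Primrec (invRev (α := ℕ)) :=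
  Primrec.list_reverse.comp (Primrec.list_map Primrec.id
    ((Primrec.fst.comp Primrec.snd).pair (Primrec.not.comp (Primrec.snd.comp Primrec.snd))))

theorem primrec_substWord : Primrec₂ substWord := by
  have h : Primrec₂ fun (p : List (List (ℕ × Bool)) × List (ℕ × Bool)) (x : ℕ × Bool) =>
      p.1.getD x.1 [] :=
    (Primrec.list_getD []).comp (Primrec.fst.comp Primrec.fst) (Primrec.fst.comp Primrec.snd)
  exact Primrec.list_flatMap Primrec.snd
    (Primrec.cond (Primrec.snd.comp Primrec.snd) h (primrec_invRev.comp h))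

theorem primrec_conjWord (R : List (List (ℕ × Bool))) : Primrec (conjWord R) := by
  have h : Primrec fun x : ConjCode => R.getD x.2.2.1 [] :=
    (Primrec.list_getD []).comp (Primrec.const R)
      (Primrec.fst.comp (Primrec.snd.comp Primrec.snd))
  refine Primrec.list_append.comp Primrec.fst (Primrec.list_append.comp
    (primrec_substWord.comp (Primrec.fst.comp Primrec.snd) (Primrec.cond
      (Primrec.snd.comp (Primrec.snd.comp Primrec.snd)) h (primrec_invRev.comp h)))
    (primrec_invRev.comp Primrec.fst))

theorem primrec_consequence (R : List (List (ℕ × Bool))) : Primrec (consequence R) :=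
  Primrec.list_flatMap Primrec.id ((primrec_conjWord R).comp Primrec.snd)

theorem primrec_reduce : Primrec (reduce (α := ℕ)) := by
  let step : (ℕ × Bool) × List (ℕ × Bool) → List (ℕ × Bool) := fun x =>
    List.casesOn x.2 [x.1] fun y L =>
      if x.1.1 = y.1 ∧ x.1.2 = !y.2 then L else x.1 :: y :: L
  have hstep : Primrec step := by
    have hx : Primrec fun z : ((ℕ × Bool) × List (ℕ × Bool)) × (ℕ × Bool) × List (ℕ × Bool) =>
      z.1.1 := Primrec.fst.comp Primrec.fst
    have hy : Primrec fun z : ((ℕ × Bool) × List (ℕ × Bool)) × (ℕ × Bool) × List (ℕ × Bool) =>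
      z.2.1 := Primrec.fst.comp Primrec.snd
    have hL : Primrec fun z : ((ℕ × Bool) × List (ℕ × Bool)) × (ℕ × Bool) × List (ℕ × Bool) =>
      z.2.2 := Primrec.snd.comp Primrec.snd
    refine Primrec.list_casesOn
      (h := fun (x : (ℕ × Bool) × List (ℕ × Bool)) (z : (ℕ × Bool) × List (ℕ × Bool)) =>
        if x.1.1 = z.1.1 ∧ x.1.2 = !z.1.2 then z.2 else x.1 :: z.1 :: z.2)
      Primrec.snd (Primrec.list_cons.comp Primrec.fst (Primrec.const [])) ?_
    refine Primrec.ite (PrimrecPred.and ?_ ?_) hL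
      (Primrec.list_cons.comp hx (Primrec.list_cons.comp hy hL))
    · exact Primrec.eq.comp (Primrec.fst.comp hx) (Primrec.fst.comp hy)
    · exact Primrec.eq.comp (Primrec.snd.comp hx) (Primrec.not.comp (Primrec.snd.comp hy))
  refine (Primrec.list_foldr (h := fun _ => step) Primrec.id (Primrec.const [])
    (hstep.comp Primrec.snd)).of_eq fun L => ?_
  induction L with
  | nil => rfl
  | cons x L ih =>
    rw [reduce.cons, ← ih]
    rfl

end FreeGroup

open FreeGroup in
/-- The data `c` certifies that the labels `t = (k, l, b)` represent a member of the category: the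
words of the two rows differ by the consequence with data `c`. -/
def Certifies (R : List (List (ℕ × Bool))) (t : ℕ × ℕ × List ℕ) (c : List ConjCode) : Prop :=
  (t.2.2.length = t.1 + t.2.1 ∧ t.1 % 2 = t.2.1 % 2) ∧
    reduce (altWord (t.2.2.take t.1)) =
      reduce (altWord (t.2.2.drop t.1) ++ consequence R c)

instance (R : List (List (ℕ × Bool))) (z : (ℕ × ℕ × List ℕ) × List FreeGroup.ConjCode) :
    Decidable (Certifies R z.1 z.2) :=
  inferInstanceAs (Decidable (_ ∧ _))

open FreeGroup in
theorem primrecPred_certifies (R : List (List (ℕ × Bool))) :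
    PrimrecPred fun z : (ℕ × ℕ × List ℕ) × List ConjCode => Certifies R z.1 z.2 := by
  have hk : Primrec fun z : (ℕ × ℕ × List ℕ) × List ConjCode => z.1.1 :=
    Primrec.fst.comp Primrec.fst
  have hl : Primrec fun z : (ℕ × ℕ × List ℕ) × List ConjCode => z.1.2.1 :=
    Primrec.fst.comp (Primrec.snd.comp Primrec.fst)
  have hb : Primrec fun z : (ℕ × ℕ × List ℕ) × List ConjCode => z.1.2.2 :=
    Primrec.snd.comp (Primrec.snd.comp Primrec.fst)
  refine PrimrecPred.and (PrimrecPred.and ?_ ?_) ?_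
  · exact Primrec.eq.comp (Primrec.list_length.comp hb) (Primrec.nat_add.comp hk hl)
  · exact Primrec.eq.comp (Primrec.nat_mod.comp hk (Primrec.const 2))
      (Primrec.nat_mod.comp hl (Primrec.const 2))
  · exact Primrec.eq.comp
      (primrec_reduce.comp (primrec_altWord.comp (Primrec.list_take.comp hk hb)))
      (primrec_reduce.comp (Primrec.list_append.comp
        (primrec_altWord.comp (Primrec.list_drop.comp hk hb))
        ((primrec_consequence R).comp Primrec.snd)))

open FreeGroup GroupVariety PointPartition in
theorem exists_certifies_iff (R : List (List (ℕ × Bool))) {k l : ℕ} {b : List ℕ}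
    (hb : b.length = k + l) :
    (∃ c, Certifies R (k, l, b) c) ↔
      Setoid.ker (fun x : Fin k ⊕ Fin l => b[(finSumFinEquiv x : ℕ)]?) ∈
        (partitionCategory (variety.{u} {r | ∃ L ∈ R, mk L = r})).carrier k l := by
  have hpar : k % 2 = l % 2 ↔ (Even k ↔ Even l) := by
    rw [Nat.even_iff, Nat.even_iff]; omega
  rw [mem_partitionCategory_iff _ hb, isIdentityOf_variety_iff, mem_consequences, ← hpar,
    ← exists_and_left]
  refine exists_congr fun c => ?_
  simp only [Certifies, hb, true_and]
  refine and_congr_right fun _ => ?_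
  rw [eq_inv_mul_iff_mul_eq, mul_mk]
  exact ⟨fun h => (reduce.exact h).symm, fun h => reduce.sound h.symm⟩

open FreeGroup GroupVariety PointPartition in
/-- All pairs of labels and certificates are enumerated, and the labels with a valid certificate
are listed. -/
theorem partitionCategory_isRecursivelyEnumerable (R : List (List (ℕ × Bool))) :
    (partitionCategory (variety.{u} {r | ∃ L ∈ R, mk L = r})).IsRecursivelyEnumerable := by
  -- The empty partition is listed in place of an invalid pair.
  let f : (ℕ × ℕ × List ℕ) × List ConjCode → ℕ × ℕ × List ℕ := fun z =>
    if Certifies R z.1 z.2 then z.1 else (0, 0, [])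
  have hf : Primrec f :=
    Primrec.ite (primrecPred_certifies R) Primrec.fst (Primrec.const (0, 0, []))
  have hempty : Certifies R (0, 0, []) [] := ⟨⟨rfl, rfl⟩, rfl⟩
  have hfc : ∀ z, ∃ c, Certifies R (f z) c := by
    intro z
    by_cases h : Certifies R z.1 z.2
    · exact ⟨z.2, by simpa only [f, if_pos h] using h⟩
    · exact ⟨[], by simpa only [f, if_neg h] using hempty⟩
  refine ⟨fun n => ((Encodable.decode n).map f).getD (0, 0, []),
    (Primrec.option_getD.comp (Primrec.option_map Primrec.decode (hf.comp Primrec.snd).to₂)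
      (Primrec.const (0, 0, []))).to_comp, fun n => ?_, fun k l p hp => ?_⟩
  · have h : ∃ c, Certifies R (((Encodable.decode n).map f).getD (0, 0, [])) c := by
      cases Encodable.decode (α := (ℕ × ℕ × List ℕ) × List ConjCode) n with
      | none => exact ⟨[], hempty⟩
      | some z => exact hfc z
    beta_reduce
    generalize ((Encodable.decode n).map f).getD (0, 0, []) = t at h
    obtain ⟨k, l, b⟩ := t
    have hb : b.length = k + l := h.choose_spec.1.1
    exact ⟨k, l, _, (exists_certifies_iff R hb).1 h, rfl, rfl, hb, rfl⟩
  · obtain ⟨b, hpb⟩ := exists_isRepresentedBy p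
    obtain ⟨-, -, hb, hpb'⟩ := id hpb
    obtain ⟨c, hc⟩ := (exists_certifies_iff R hb).2 (hpb' ▸ hp)
    refine ⟨Encodable.encode ((k, l, b), c), ?_⟩
    simpa only [Encodable.encodek, Option.map_some, Option.getD_some, f, if_pos hc] using hpb

theorem mainTheorem3 (V : Set GrpCat.{u}) (hV : GroupVariety.IsFinitelyBasedVariety V) :
    ∃ C : PartitionCategory, C.IsRecursivelyEnumerable ∧
      ∀ (w : FreeGroup ℕ) (n : ℕ) (i : Fin n → ℕ),
        Involutions.wordProd i = Involutions.embedding w →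
          (GroupVariety.IsIdentityOf w V ↔ PointPartition.ofIndices i ∈ C.carrier 0 n) := by
  refine ⟨partitionCategory V, ?_, fun w n i h => isIdentityOf_iff_ofIndices_mem V h⟩
  obtain ⟨W, hW, rfl⟩ := hV
  have hR : W = {r | ∃ L ∈ hW.toFinset.toList.map FreeGroup.toWord, FreeGroup.mk L = r} := by
    ext w
    simp [FreeGroup.mk_toWord]
  rw [hR]
  exact partitionCategory_isRecursivelyEnumerable _
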